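/- **Proposition (Block diagonal form of $\mathcal M$ for free, particle number preserving unitaries).** Consider $L$ fermionic modes with annihilation and creation operators $a_j, a_j^\dagger$ ($0\le j\le L-1$) on the Fock space with orthonormal Fock basis $|\boldsymbol n\rangle=(a_0^\dagger)^{n_0}\cdots(a_{L-1}^\dagger)^{n_{L-1}}|\boldsymbol 0\rangle$, $\boldsymbol n\in\{0,1\}^L$. Let $U\sim\mathcal U$ be a random operator, distributed according to any probability distribution on the free, particle number preserving unitaries, i.e. the operators $e^{iHt}$ with $t\in\mathbb R$ and $H=\sum_{i,j}h_{i,j}a_i^\dagger a_j$, $h\in\mathbb C^{L\times L}$ Hermitian. Each such $U$ has a unique mode space matrix $u$, defined by $Ua_iU^\dagger=\sum_j u_{i,j}a_j$ for all $i$, and $u$ is unitary. Let $$\mathcal M(A)=\sum_{\boldsymbol n\in\{0,1\}^L}\mathbb E_{U\sim\mathcal U}\,\langle\boldsymbol n|UAU^\dagger|\boldsymbol n\rangle\,U^\dagger|\boldsymbol n\rangle\langle\boldsymbol n|U$$ be the measurement channel, and for $k\in\mathbb N$ let $W_{2k}$ be the span of all $2k$-point correlation operators $a^\dagger_{i_1}\cdots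 a^\dagger_{i_k}a_{j_1}\cdots a_{j_k}$. For tuples $x,y,p,q$ of $t$ mode indices let $$\Phi_t(x,y;p,q)=\mathbb E_{U\sim\mathcal U}\prod_{a=1}^t\overline{u}_{x_a,p_a}\prod_{a=1}^t u_{y_a,q_a}$$ be the entries of the $t$-th moment operator. For $t=2k$ write $\Phi_{2k}(\boldsymbol i,\boldsymbol i',\boldsymbol j,\boldsymbol j';\boldsymbol p,\boldsymbol p',\boldsymbol q,\boldsymbol q')$, with $k$-tuples as arguments, for the entry at the concatenated tuples $x=(\boldsymbol i,\boldsymbol i')$, $y=(\boldsymbol j,\boldsymbol j')$, $p=(\boldsymbol p,\boldsymbol p')$, $q=(\boldsymbol q,\boldsymbol q')$. All these expectations are well defined, and $\mathcal M$ is block diagonal with respect to the subspaces $W_{2k}$: $\mathcal M(W_{2k})\subseteq W_{2k}$ for every $k$. More precisely, for all $k$-tuples $\boldsymbol i,\boldsymbol j$ of mode indices, $$\mathcal M(a^\dagger_{i_1}\cdots a^\dagger_{i_k}a_{j_1}\cdots a_{j_k})=\sum_{\boldsymbol l,\boldsymbol m}M^{(2k)}_{\boldsymbol i\boldsymbol j,\boldsymbol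 l\boldsymbol m}\,a^\dagger_{l_1}\cdots a^\dagger_{l_k}a_{m_1}\cdots a_{m_k},$$ where the sum is over all $k$-tuples $\boldsymbol l,\boldsymbol m$ of mode indices and, with $(\pi\boldsymbol j)_a=j_{\pi(a)}$, $$M^{(2k)}_{\boldsymbol i\boldsymbol j,\boldsymbol l\boldsymbol m}=\frac1{(k!)^2}\sum_{\boldsymbol p}\sum_{\pi,\sigma,\lambda\in\mathcal S_k}\mathrm{sgn}(\pi\sigma\lambda)\,\Phi_{2k}(\boldsymbol i,\sigma\boldsymbol m,\pi\boldsymbol j,\lambda\boldsymbol l;\boldsymbol p,\boldsymbol p,\boldsymbol p,\boldsymbol p)$$ $$=\frac1{(k!)^2}\sum_{\boldsymbol p}\sum_{\pi,\sigma,\lambda\in\mathcal S_k}\mathrm{sgn}(\pi\sigma\lambda)\,\mathbb E_{U\sim\mathcal U}\prod_{a=1}^k(u^\dagger)_{p_a,i_a}\prod_{a=1}^k(u^\dagger)_{p_a,m_{\sigma(a)}}\prod_{a=1}^k u_{j_{\pi(a)},p_a}\prod_{a=1}^k u_{l_{\lambda(a)},p_a}.$$ The coefficient $M^{(2k)}_{\boldsymbol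 i\boldsymbol j,\boldsymbol l\boldsymbol m}$ is antisymmetric under permutations of the indices within each of $\boldsymbol i$, $\boldsymbol j$, $\boldsymbol l$ and $\boldsymbol m$ (a permutation $\rho$ multiplies it by $\mathrm{sgn}(\rho)$), and Hermitian under exchanging $(\boldsymbol i,\boldsymbol j)$ with $(\boldsymbol l,\boldsymbol m)$: $M^{(2k)}_{\boldsymbol i\boldsymbol j,\boldsymbol l\boldsymbol m}=\overline{M^{(2k)}_{\boldsymbol l\boldsymbol m,\boldsymbol i\boldsymbol j}}$. -/

import Mathlib

open MeasureTheory

noncomputable section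

/-- Operators on the Fock space of `L` fermionic modes, written as matrices in the orthonormal Fock
basis. The basis vector `|n⟩`, `n ∈ {0,1}^L`, is labelled by the set `S = {j | n_j = 1}` of
occupied modes. -/
abbrev FockOp (L : ℕ) : Type := Matrix (Finset (Fin L)) (Finset (Fin L)) ℂ

/-- The annihilation operator `a_j` in the Fock basis
`|n⟩ = (a_0†)^{n_0} ⋯ (a_{L-1}†)^{n_{L-1}} |0⟩`: it sends `|T⟩` to
`(-1)^{#{i ∈ T, i < j}} |T \ {j}⟩` if `j ∈ T`, and to `0` otherwise. -/
def annihilation {L : ℕ} (j : Fin L) : FockOp L :=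
  Matrix.of fun S T =>
    if j ∈ T ∧ S = T.erase j then (-1 : ℂ) ^ (T.filter (fun i => i < j)).card else 0

/-- The creation operator `a_j†`. -/
def creation {L : ℕ} (j : Fin L) : FockOp L := (annihilation j).conjTranspose

/-- The operator `∑_{i,j} h_{i,j} a_i† a_j`. -/
def quadraticHamiltonian {L : ℕ} (h : Matrix (Fin L) (Fin L) ℂ) : FockOp L :=
  ∑ i, ∑ j, h i j • (creation i * annihilation j)

/-- `U` is a free, particle number preserving unitary: `U = exp (i t H)` with
`H = ∑ h_{i,j} a_i† a_j` for some Hermitian matrix `h` and some real time `t`. -/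
def IsFreeNumberPreserving {L : ℕ} (U : FockOp L) : Prop :=
  ∃ (h : Matrix (Fin L) (Fin L) ℂ) (t : ℝ), h.IsHermitian ∧
    U = NormedSpace.exp ((Complex.I * (t : ℂ)) • quadraticHamiltonian h)

/-- `u` is a mode space matrix of `U`: `U a_i U† = ∑_j u_{i,j} a_j` for all `i`. -/
def IsModeMatrix {L : ℕ} (U : FockOp L) (u : Matrix (Fin L) (Fin L) ℂ) : Prop :=
  ∀ i, U * annihilation i * U.conjTranspose = ∑ j, u i j • annihilation j

/-- The `2k`-point correlation operator `a_{i_1}† ⋯ a_{i_k}† a_{j_1} ⋯ a_{j_k}`. -/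
def corrOp {L k : ℕ} (i j : Fin k → Fin L) : FockOp L :=
  (List.ofFn fun r => creation (i r)).prod * (List.ofFn fun r => annihilation (j r)).prod

/-- The `2k`-point subspace `W_{2k}`, spanned by all `2k`-point correlation operators. -/
def corrSubspace (L k : ℕ) : Submodule ℂ (FockOp L) :=
  Submodule.span ℂ {A | ∃ i j : Fin k → Fin L, A = corrOp i j}

/-- The matrix element `(S, T)` of `⟨n| U A U† |n⟩ U† |n⟩⟨n| U`. -/
def channelIntegrand {L : ℕ} (U A : FockOp L) (n S T : Finset (Fin L)) : ℂ :=
  (U * A * U.conjTranspose) n n * (U.conjTranspose * Matrix.single n n (1 : ℂ) * U) S T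

/-- The measurement channel `A ↦ ∑_n 𝔼_U ⟨n| U A U† |n⟩ U† |n⟩⟨n| U` of the ensemble given by the
random operator `U` on the probability space `(Ω, μ)`. -/
def measurementChannel {Ω : Type*} [MeasurableSpace Ω] {L : ℕ} (μ : Measure Ω)
    (U : Ω → FockOp L) (A : FockOp L) : FockOp L :=
  Matrix.of fun S T => ∑ n : Finset (Fin L), ∫ ω, channelIntegrand (U ω) A n S T ∂μ

/-- The matrix element `Φ_t(x, y; p, q) = 𝔼_u ∏_a conj (u_{x_a, p_a}) ∏_a u_{y_a, q_a}` of the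
`t`-th moment operator. -/
def momentEntry {Ω : Type*} [MeasurableSpace Ω] {L t : ℕ} (μ : Measure Ω)
    (u : Ω → Matrix (Fin L) (Fin L) ℂ) (x y p q : Fin t → Fin L) : ℂ :=
  ∫ ω, (∏ a, star (u ω (x a) (p a))) * ∏ a, u ω (y a) (q a) ∂μ

/-- The coefficient `M^{(2k)}_{ij,lm}`, namely `(k!)⁻²` times the sum over `p` and `π, σ, τ ∈ S_k`
of `sgn(π σ τ) Φ_{2k}(i, σ m, π j, τ l; p, p, p, p)`, where `(π j)_a = j_{π a}` and a
comma-separated pair of `k`-tuples denotes the concatenated `2k`-tuple. -/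
def channelCoeff {Ω : Type*} [MeasurableSpace Ω] {L k : ℕ} (μ : Measure Ω)
    (u : Ω → Matrix (Fin L) (Fin L) ℂ) (i j l m : Fin k → Fin L) : ℂ :=
  ((k.factorial : ℂ) ^ 2)⁻¹ *
    ∑ p : Fin k → Fin L, ∑ π : Equiv.Perm (Fin k), ∑ σ : Equiv.Perm (Fin k),
      ∑ τ : Equiv.Perm (Fin k),
        ((Equiv.Perm.sign (π * σ * τ) : ℤ) : ℂ) *
          momentEntry μ u (Fin.append i (m ∘ σ)) (Fin.append (j ∘ π) (l ∘ τ))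
            (Fin.append p p) (Fin.append p p)

end

/-! For a fixed unitary the sum over `n` is dephasing in a rotated Fock basis: the operator is `U†
diag(U A U†) U` (`sum_channelIntegrand`). The formula is proved at this level and averaged only at
the end.

Conjugation by `U` acts linearly on the `a_i`, so `U a†_i⋯a_j⋯ U†` is a combination of the operators
`corrOp p q`, with products of entries of `u` as coefficients (`IsModeMatrix.conj_corrOp`). A
correlation operator has a nonzero Fock-diagonal entry only if `q` is a rearrangement `p ∘ π` of an
injective `p`. It then equals `sgn π • corrOp p p`, which is diagonal. Hence dephasing leaves a
signed sum over `p` and `π` (`diagonal_sum_smul_corrOp`). Rotating back with `u†` gives correlation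
operators of the same order, so `W_{2k}` is preserved. Averaging the coefficients over permutations
of `l` and `m` adds the sums over `σ`, `τ` and the factor `(k!)⁻²`
(`sum_smul_corrOp_antisymmetrize`).

Antisymmetry and Hermiticity hold for each `U` separately, by reindexing the signed sum
(`signedPermSum_reindex`, `signedPermSum_inv`). All integrands are bounded and measurable, so
integrals commute with the finite sums. -/

/-! ### Canonical anticommutation relations in the Fock basis. -/

section JordanWigner

variable {L : ℕ}

/-- The sign `(-1)^{#{i ∈ T, i < j}}`. -/
noncomputable def jordanWignerSign (T : Finset (Fin L)) (j : Fin L) : ℂ :=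
  (-1 : ℂ) ^ (T.filter (fun i => i < j)).card

lemma jordanWignerSign_mul_self (T : Finset (Fin L)) (j : Fin L) :
    jordanWignerSign T j * jordanWignerSign T j = 1 := by
  unfold jordanWignerSign
  rw [← mul_pow]; simp

lemma jordanWignerSign_insert {T : Finset (Fin L)} {i : Fin L} (hi : i ∉ T) (j : Fin L) :
    jordanWignerSign (insert i T) j =
      if i < j then -jordanWignerSign T j else jordanWignerSign T j := by
  unfold jordanWignerSign
  rw [Finset.filter_insert]
  split_ifs with h
  · rw [Finset.card_insert_of_notMem (by simp [hi]), pow_succ]; ring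
  · rfl

lemma jordanWignerSign_erase {T : Finset (Fin L)} {i : Fin L} (hi : i ∈ T) (j : Fin L) :
    jordanWignerSign (T.erase i) j =
      if i < j then -jordanWignerSign T j else jordanWignerSign T j := by
  have := jordanWignerSign_insert (Finset.notMem_erase i T) j
  rw [Finset.insert_erase hi] at this
  rw [this]
  split_ifs <;> simp

lemma star_jordanWignerSign (T : Finset (Fin L)) (j : Fin L) :
    star (jordanWignerSign T j) = jordanWignerSign T j := by
  simp [jordanWignerSign]

lemma annihilation_apply (j : Fin L) (S T : Finset (Fin L)) :
    annihilation j S T = if j ∈ T ∧ S = T.erase j then jordanWignerSign T j else 0 := rfl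

lemma creation_apply (j : Fin L) (S T : Finset (Fin L)) :
    creation j S T = if j ∈ S ∧ T = S.erase j then jordanWignerSign S j else 0 := by
  rw [creation, Matrix.conjTranspose_apply, annihilation_apply]
  split_ifs <;> simp [star_jordanWignerSign]

lemma conjTranspose_annihilation (j : Fin L) : (annihilation j).conjTranspose = creation j := rfl

lemma conjTranspose_creation (j : Fin L) : (creation j).conjTranspose = annihilation j := by
  simp [creation]

lemma mul_annihilation_apply (M : FockOp L) (j : Fin L) (S T : Finset (Fin L)) :
    (M * annihilation j) S T = if j ∈ T then M S (T.erase j) * jordanWignerSign T j else 0 := by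
  rw [Matrix.mul_apply, Finset.sum_eq_single (T.erase j)]
  · simp [annihilation_apply]
  · intro R _ hR; simp [annihilation_apply, hR]
  · simp

lemma mul_creation_apply (M : FockOp L) (j : Fin L) (S T : Finset (Fin L)) :
    (M * creation j) S T = if j ∈ T then 0 else M S (insert j T) * jordanWignerSign T j := by
  rw [Matrix.mul_apply, Finset.sum_eq_single (insert j T)]
  · by_cases h : j ∈ T
    · simp [creation_apply, h]
      intro h'; rw [h'] at h; simp at h
    · simp [creation_apply, h, jordanWignerSign_insert h]
  · intro R _ hR
    rw [creation_apply, if_neg, mul_zero]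
    rintro ⟨h1, rfl⟩
    exact hR (Finset.insert_erase h1).symm
  · simp

/-- Removing the smaller mode changes the number of occupied modes below the larger one, but not
conversely, so the two orders differ by exactly one sign. -/
lemma annihilation_anticomm (i j : Fin L) :
    annihilation i * annihilation j = -(annihilation j * annihilation i) := by
  rcases eq_or_ne i j with rfl | hij
  · ext S T
    rw [Matrix.neg_apply, mul_annihilation_apply]
    simp [annihilation_apply]
  · ext S T
    rw [Matrix.neg_apply, mul_annihilation_apply, mul_annihilation_apply, annihilation_apply,
      annihilation_apply, Finset.erase_right_comm]
    by_cases hi : i ∈ T <;> by_cases hj : j ∈ T <;>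
      simp [hi, hj, hij, hij.symm]
    rw [jordanWignerSign_erase hi, jordanWignerSign_erase hj]
    rcases lt_or_gt_of_ne hij with h | h <;> simp [h, h.not_gt] <;> split_ifs <;> ring

lemma annihilation_creation_anticomm (i j : Fin L) :
    annihilation i * creation j + creation j * annihilation i = if i = j then 1 else 0 := by
  ext S T
  rw [Matrix.add_apply, mul_annihilation_apply, mul_creation_apply, creation_apply,
    annihilation_apply]
  rcases eq_or_ne i j with rfl | hij
  · simp only [if_true, Matrix.one_apply]
    by_cases hi : i ∈ T
    · have : (i ∈ S ∧ T.erase i = S.erase i) ↔ S = T := by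
        constructor
        · rintro ⟨h1, h2⟩
          rw [← Finset.insert_erase h1, ← h2, Finset.insert_erase hi]
        · rintro rfl; exact ⟨hi, rfl⟩
      simp only [hi, if_true, this]
      split_ifs with h
      · subst h; simp [jordanWignerSign_mul_self]
      · simp
    · simp only [hi, if_false, Finset.mem_insert_self, true_and, Finset.erase_insert hi,
        jordanWignerSign_insert hi, lt_irrefl]
      split_ifs with h <;> simp [jordanWignerSign_mul_self]
  · rw [if_neg hij, Matrix.zero_apply]
    by_cases hi : i ∈ T <;> by_cases hj : j ∈ T <;> simp [hi, hj, hij]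
    · intro h1 h2
      have : j ∈ T.erase i := by simp [hj, hij.symm]
      rw [h2] at this; simp at this
    · have key : (j ∈ S ∧ T.erase i = S.erase j) ↔ S = (insert j T).erase i := by
        rw [Finset.erase_insert_of_ne hij.symm]
        have hj' : j ∉ T.erase i := by simp [hj]
        constructor
        · rintro ⟨h1, h2⟩
          rw [h2, Finset.insert_erase h1]
        · rintro rfl
          simp [Finset.erase_insert hj']
      simp only [key]
      split_ifs with h
      · subst h
        rw [Finset.erase_insert_of_ne hij.symm, jordanWignerSign_insert hj,
          jordanWignerSign_insert (by simp [hj] : j ∉ T.erase i), jordanWignerSign_erase hi]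
        rcases lt_or_gt_of_ne hij with h | h <;> simp [h, h.not_gt] <;> ring
      · simp

lemma creation_anticomm (i j : Fin L) :
    creation i * creation j = -(creation j * creation i) := by
  have := congrArg Matrix.conjTranspose (annihilation_anticomm j i)
  simpa [Matrix.conjTranspose_mul, conjTranspose_annihilation] using this

end JordanWigner

/-! ### Products of pairwise anticommuting elements. -/

section AnticommutingProducts

variable {A : Type*} [Ring A] [Algebra ℂ A] {ι : Type*} [Fintype ι]

/-- Exchanging the two summation indices shows that the square equals its own negative. This is the
condition for extending `v ↦ ∑ v i • x i` to the exterior algebra. -/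
lemma sq_sum_smul_eq_zero {x : ι → A} (hx : ∀ i j, x i * x j = -(x j * x i)) (v : ι → ℂ) :
    (∑ i, v i • x i) * (∑ i, v i • x i) = 0 := by
  have h : (∑ i, v i • x i) * (∑ i, v i • x i) = -((∑ i, v i • x i) * (∑ i, v i • x i)) := by
    conv_lhs => rw [Finset.sum_mul_sum, Finset.sum_comm]
    rw [Finset.sum_mul_sum, ← Finset.sum_neg_distrib]
    refine Finset.sum_congr rfl fun i _ => ?_
    rw [← Finset.sum_neg_distrib]
    refine Finset.sum_congr rfl fun j _ => ?_
    rw [smul_mul_smul_comm, smul_mul_smul_comm, hx j i, smul_neg, mul_comm]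
  have h2 : (2 : ℂ) • ((∑ i, v i • x i) * (∑ i, v i • x i)) = 0 := by
    rw [two_smul]; nth_rewrite 1 [h]; simp
  exact (smul_eq_zero_iff_right two_ne_zero).1 h2

/-- The alternating map sending basis vectors to products of pairwise anticommuting elements. -/
lemma exists_alternatingMap_prod {x : ι → A} (hx : ∀ i j, x i * x j = -(x j * x i)) (k : ℕ) :
    ∃ f : (ι → ℂ) [⋀^Fin k]→ₗ[ℂ] A, ∀ v, f v = (List.ofFn fun r => ∑ i, v r i • x i).prod := by
  let g : (ι → ℂ) →ₗ[ℂ] A := ∑ i, (LinearMap.proj i).smulRight (x i)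
  have hg : ∀ v, g v = ∑ i, v i • x i := fun v => by simp [g]
  let G := ExteriorAlgebra.lift ℂ ⟨g, fun v => by rw [hg]; exact sq_sum_smul_eq_zero hx v⟩
  refine ⟨G.toLinearMap.compAlternatingMap (ExteriorAlgebra.ιMulti ℂ k), fun v => ?_⟩
  simp only [LinearMap.compAlternatingMap_apply, AlgHom.toLinearMap_apply,
    ExteriorAlgebra.ιMulti_apply, map_list_prod, List.map_ofFn]
  congr 2
  funext r
  simp [G, hg]

/-- The sign rule for alternating maps, evaluated at standard basis vectors, where each sum
collapses to one factor. -/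
lemma prod_ofFn_comp_perm {x : ι → A} (hx : ∀ i j, x i * x j = -(x j * x i)) {k : ℕ}
    (p : Fin k → ι) (σ : Equiv.Perm (Fin k)) :
    (List.ofFn fun r => x (p (σ r))).prod =
      ((Equiv.Perm.sign σ : ℤ) : ℂ) • (List.ofFn fun r => x (p r)).prod := by
  classical
  obtain ⟨f, hf⟩ := exists_alternatingMap_prod hx k
  have h := f.map_perm (fun r => Pi.single (p r) (1 : ℂ)) σ
  have e : ∀ q : Fin k → ι, f (fun r => Pi.single (q r) (1 : ℂ)) =
      (List.ofFn fun r => x (q r)).prod := fun q => by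
    rw [hf]; simp [Pi.single_apply]
  rw [e] at h
  have := e (p ∘ σ)
  simp only [Function.comp_def] at this h
  rw [← this, h]
  rcases Int.units_eq_one_or (Equiv.Perm.sign σ) with h | h <;> simp [h]

lemma prod_ofFn_sum_smul (k : ℕ) (x : ι → A) (c : Fin k → ι → ℂ) :
    (List.ofFn fun r => ∑ i, c r i • x i).prod =
      ∑ p : Fin k → ι, (∏ r, c r (p r)) • (List.ofFn fun r => x (p r)).prod := by
  classical
  have := (MultilinearMap.mkPiAlgebraFin ℂ k A).map_sum (fun r i => c r i • x i)
  simp only [MultilinearMap.mkPiAlgebraFin_apply] at this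
  rw [this]
  refine Finset.sum_congr rfl fun p _ => ?_
  have := (MultilinearMap.mkPiAlgebraFin ℂ k A).map_smul_univ (fun r => c r (p r))
    (fun r => x (p r))
  simpa using this

end AnticommutingProducts

/-! ### Supports of correlation operators and their Fock-diagonal part. -/

section Supports

variable {L : ℕ}

lemma annihilation_list_prod_ne_zero (l : List (Fin L)) {S T : Finset (Fin L)}
    (h : (l.map annihilation).prod S T ≠ 0) : l.Nodup ∧ l.toFinset ⊆ T ∧ S = T \ l.toFinset := by
  induction l generalizing S with
  | nil =>
    simp only [List.map_nil, List.prod_nil, Matrix.one_apply, ne_eq, ite_eq_right_iff,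
      one_ne_zero, imp_false, not_not] at h
    simp [h]
  | cons a l ih =>
    rw [List.map_cons, List.prod_cons, Matrix.mul_apply] at h
    obtain ⟨R, -, hR⟩ := Finset.exists_ne_zero_of_sum_ne_zero h
    obtain ⟨h1, h2, h3⟩ := ih (right_ne_zero_of_mul hR)
    have h4 := left_ne_zero_of_mul hR
    rw [annihilation_apply, ne_eq, ite_eq_right_iff, Classical.not_imp] at h4
    obtain ⟨⟨h5, h6⟩, -⟩ := h4
    subst h6 h3
    simp only [Finset.mem_sdiff, List.mem_toFinset] at h5
    refine ⟨List.nodup_cons.2 ⟨h5.2, h1⟩, ?_, ?_⟩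
    · rw [List.toFinset_cons, Finset.insert_subset_iff]; exact ⟨h5.1, h2⟩
    · ext; simp; tauto

lemma creation_list_prod_ne_zero (l : List (Fin L)) {S T : Finset (Fin L)}
    (h : (l.map creation).prod S T ≠ 0) : l.Nodup ∧ l.toFinset ⊆ S ∧ T = S \ l.toFinset := by
  -- Taking adjoints reduces to annihilation operators with the roles of `S` and `T` exchanged;
  -- reversing the list does not affect its set of entries.
  have e : (l.map creation).prod = ((l.reverse.map annihilation).prod).conjTranspose := by
    induction l with
    | nil => simp
    | cons a l ih =>
      simp only [List.map_cons, List.prod_cons, List.reverse_cons, List.map_append,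
        List.prod_append, Matrix.conjTranspose_mul, List.map_nil, List.prod_nil, mul_one,
        conjTranspose_annihilation]
      congr 1
      clear h ih
      induction l with
      | nil => simp
      | cons a l ih => simp [Matrix.conjTranspose_mul, conjTranspose_annihilation, ih]
  rw [e, Matrix.conjTranspose_apply, star_ne_zero] at h
  simpa using annihilation_list_prod_ne_zero _ h

/-- Both differences are the intermediate state: `T` emptied of the modes `q`, to which the modes
`p` are added to reach `S`. Signs play no role. -/
lemma corrOp_apply_ne_zero {k : ℕ} {p q : Fin k → Fin L} {S T : Finset (Fin L)}
    (h : corrOp p q S T ≠ 0) : Function.Injective p ∧ Function.Injective q ∧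
      Finset.univ.image p ⊆ S ∧ Finset.univ.image q ⊆ T ∧
      S \ Finset.univ.image p = T \ Finset.univ.image q := by
  have hp : ∀ r : Fin k → Fin L, (List.ofFn r).toFinset = Finset.univ.image r := fun r => by
    ext; simp
  rw [corrOp, Matrix.mul_apply] at h
  obtain ⟨R, -, hR⟩ := Finset.exists_ne_zero_of_sum_ne_zero h
  have h1 := creation_list_prod_ne_zero (List.ofFn p) (S := S) (T := R)
    (by rw [List.map_ofFn]; exact left_ne_zero_of_mul hR)
  have h2 := annihilation_list_prod_ne_zero (List.ofFn q) (S := R) (T := T)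
    (by rw [List.map_ofFn]; exact right_ne_zero_of_mul hR)
  rw [List.nodup_ofFn, hp] at h1 h2
  exact ⟨h1.1, h2.1, h1.2.1, h2.2.1, h1.2.2.symm.trans h2.2.2⟩

lemma corrOp_comp_perm {k : ℕ} (p q : Fin k → Fin L) (σ τ : Equiv.Perm (Fin k)) :
    corrOp (p ∘ σ) (q ∘ τ) =
      (((Equiv.Perm.sign σ : ℤ) : ℂ) * ((Equiv.Perm.sign τ : ℤ) : ℂ)) • corrOp p q := by
  unfold corrOp
  simp only [Function.comp_apply]
  rw [prod_ofFn_comp_perm creation_anticomm, prod_ofFn_comp_perm annihilation_anticomm,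
    smul_mul_smul_comm]

lemma corrOp_self_isDiag {k : ℕ} (p : Fin k → Fin L) {S T : Finset (Fin L)} (h : S ≠ T) :
    corrOp p p S T = 0 := by
  by_contra h0
  obtain ⟨-, -, h1, h2, h3⟩ := corrOp_apply_ne_zero h0
  apply h
  rw [← Finset.sdiff_union_of_subset h1, h3, Finset.sdiff_union_of_subset h2]

lemma exists_perm_of_corrOp_apply_self_ne_zero {k : ℕ} {p q : Fin k → Fin L}
    {n : Finset (Fin L)} (h : corrOp p q n n ≠ 0) : ∃ π : Equiv.Perm (Fin k), p ∘ π = q := by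
  obtain ⟨hp, hq, h1, h2, h3⟩ := corrOp_apply_ne_zero h
  have him : Finset.univ.image p = Finset.univ.image q := by
    rw [← Finset.sdiff_sdiff_eq_self h1, h3, Finset.sdiff_sdiff_eq_self h2]
  have hex : ∀ r, ∃ s, p s = q r := fun r => by
    have : q r ∈ Finset.univ.image p := by rw [him]; simp
    simpa using this
  choose f hf using hex
  have hfi : Function.Injective f := fun a b hab => hq (by rw [← hf, ← hf, hab])
  exact ⟨Equiv.ofBijective f (Finite.injective_iff_bijective.1 hfi), funext hf⟩

/-- The Fock-diagonal part of a combination of correlation operators. -/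
lemma diagonal_sum_smul_corrOp {k : ℕ} (c : (Fin k → Fin L) → (Fin k → Fin L) → ℂ) :
    Matrix.diagonal (fun n => (∑ p, ∑ q, c p q • corrOp p q) n n) =
      ∑ p, ∑ π : Equiv.Perm (Fin k),
        (((Equiv.Perm.sign π : ℤ) : ℂ) * c p (p ∘ π)) • corrOp p p := by
  ext S T
  simp only [Matrix.sum_apply, Matrix.smul_apply, smul_eq_mul]
  rcases eq_or_ne S T with rfl | hST
  swap
  · simp [Matrix.diagonal_apply_ne _ hST, corrOp_self_isDiag _ hST]
  rw [Matrix.diagonal_apply_eq]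
  refine Finset.sum_congr rfl fun p _ => ?_
  -- For injective `p` distinct `π` give distinct `p ∘ π`, so the surviving `q` are enumerated
  -- without repetition. Otherwise `corrOp p q` vanishes and both sides are zero.
  by_cases hp : Function.Injective p
  · have hinj : Function.Injective fun π : Equiv.Perm (Fin k) => p ∘ π := fun π σ h =>
      Equiv.ext fun r => hp (congrFun h r)
    rw [← Finset.sum_subset (Finset.subset_univ (Finset.univ.image
      fun π : Equiv.Perm (Fin k) => p ∘ π)), Finset.sum_image fun _ _ _ _ h => hinj h]
    · refine Finset.sum_congr rfl fun π _ => ?_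
      have := corrOp_comp_perm p p 1 π
      rw [Equiv.Perm.coe_one, Function.comp_id] at this
      rw [this]; simp; ring
    · intro q _ hq
      by_contra h0
      obtain ⟨π, hπ⟩ := exists_perm_of_corrOp_apply_self_ne_zero (right_ne_zero_of_mul h0)
      exact hq (Finset.mem_image.2 ⟨π, Finset.mem_univ _, hπ⟩)
  · have : ∀ q S T, corrOp p q S T = 0 := fun q S T => by
      by_contra h0; exact hp (corrOp_apply_ne_zero h0).1
    simp [this]

end Supports

/-! ### Mode space matrices: existence, uniqueness and action on correlation operators. -/

section ModeMatrix

variable {L : ℕ}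

lemma Matrix.semiconjBy_exp_right {n : Type*} [Fintype n] [DecidableEq n]
    {B X Y : Matrix n n ℂ} (h : SemiconjBy B X Y) :
    SemiconjBy B (NormedSpace.exp X) (NormedSpace.exp Y) := by
  -- The exponential depends only on the topology, so any compatible Banach algebra norm may be used
  -- here.
  let _ : NormedRing (Matrix n n ℂ) := Matrix.linftyOpNormedRing
  let _ : NormedAlgebra ℂ (Matrix n n ℂ) := Matrix.linftyOpNormedAlgebra
  let _ : NormedAlgebra ℚ (Matrix n n ℂ) := NormedAlgebra.restrictScalars ℚ ℂ _
  exact h.exp_right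

lemma Matrix.exp_add_smul_one {n : Type*} [Fintype n] [DecidableEq n]
    (X : Matrix n n ℂ) (c : ℂ) :
    NormedSpace.exp (X + c • (1 : Matrix n n ℂ)) = Complex.exp c • NormedSpace.exp X := by
  rw [Matrix.exp_add_of_commute _ _ ((Commute.one_right X).smul_right c),
    Matrix.smul_one_eq_diagonal, Matrix.exp_diagonal]
  have : NormedSpace.exp (fun _ : n => c) = fun _ => Complex.exp c := by
    funext i
    rw [Pi.coe_exp, Complex.exp_eq_exp_ℂ]
  rw [this, ← Matrix.smul_one_eq_diagonal, mul_smul_comm, mul_one]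

lemma exp_mem_unitaryGroup {n : Type*} [Fintype n] [DecidableEq n] {X : Matrix n n ℂ}
    (h : X.conjTranspose = -X) : NormedSpace.exp X ∈ Matrix.unitaryGroup n ℂ := by
  rw [Matrix.mem_unitaryGroup_iff, Matrix.star_eq_conjTranspose, ← Matrix.exp_conjTranspose, h,
    ← Matrix.exp_add_of_commute _ _ (Commute.refl X).neg_right, add_neg_cancel,
    NormedSpace.exp_zero]

lemma conjTranspose_quadraticHamiltonian {h : Matrix (Fin L) (Fin L) ℂ} (hh : h.IsHermitian) :
    (quadraticHamiltonian h).conjTranspose = quadraticHamiltonian h := by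
  unfold quadraticHamiltonian
  simp only [Matrix.conjTranspose_sum, Matrix.conjTranspose_smul, Matrix.conjTranspose_mul,
    conjTranspose_annihilation, conjTranspose_creation]
  rw [Finset.sum_comm]
  simp only [hh.apply]

lemma IsFreeNumberPreserving.mem_unitaryGroup {U : FockOp L} (hU : IsFreeNumberPreserving U) :
    U ∈ Matrix.unitaryGroup (Finset (Fin L)) ℂ := by
  obtain ⟨h, t, hh, rfl⟩ := hU
  apply exp_mem_unitaryGroup
  rw [Matrix.conjTranspose_smul, conjTranspose_quadraticHamiltonian hh]
  simp

/-- Moving `a_i` to the left past `a_p† a_q` costs two signs, which cancel, and a contraction that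
survives only for `p = i`. -/
lemma quadraticHamiltonian_mul_annihilation (h : Matrix (Fin L) (Fin L) ℂ) (i : Fin L) :
    quadraticHamiltonian h * annihilation i =
      annihilation i * quadraticHamiltonian h - ∑ j, h i j • annihilation j := by
  have key : ∀ p q, creation p * annihilation q * annihilation i =
      annihilation i * (creation p * annihilation q) -
        if i = p then annihilation q else 0 := fun p q => by
    have h1 := annihilation_creation_anticomm i p
    have h2 : creation p * annihilation i =
      (if i = p then 1 else 0) - annihilation i * creation p := by rw [← h1]; abel
    rw [mul_assoc, annihilation_anticomm q i, mul_neg, ← mul_assoc, h2, sub_mul, mul_assoc]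
    split_ifs <;> simp
  unfold quadraticHamiltonian
  simp only [Finset.sum_mul, Finset.mul_sum, smul_mul_assoc, key, mul_smul_comm, smul_sub,
    Finset.sum_sub_distrib]
  congr 1
  rw [Finset.sum_eq_single i]
  · simp
  · intro b _ hb; simp [hb.symm]
  · simp

/-- The matrix is `exp(-ith)`. Diagonalising `h = V D V†`, the rotated modes `b_r` satisfy `[H, b_r]
= -D_r b_r`, so conjugation by `U` multiplies `b_r` by the phase `exp(-it D_r)`. Rotating back gives
`V E V†`. -/
lemma exists_isModeMatrix {U : FockOp L} (hU : IsFreeNumberPreserving U) :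
    ∃ v ∈ Matrix.unitaryGroup (Fin L) ℂ, IsModeMatrix U v := by
  have hUu := hU.mem_unitaryGroup
  obtain ⟨h, t, hh, rfl⟩ := hU
  set X := (Complex.I * (t : ℂ)) • quadraticHamiltonian h with hX
  let V := hh.eigenvectorUnitary
  let D : Fin L → ℂ := fun r => hh.eigenvalues r
  let E : Fin L → ℂ := fun r => Complex.exp (-(Complex.I * t * D r))
  let b : Fin L → FockOp L := fun r => ∑ i, (star (V : Matrix (Fin L) (Fin L) ℂ)) r i •
    annihilation i
  have hspec : h = (V : Matrix (Fin L) (Fin L) ℂ) * Matrix.diagonal D * star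
      (V : Matrix (Fin L) (Fin L) ℂ) := by
    have := hh.spectral_theorem
    rw [Unitary.conjStarAlgAut_apply] at this
    exact this
  have hVV : star (V : Matrix (Fin L) (Fin L) ℂ) * V = 1 := Unitary.coe_star_mul_self V
  have hVV' : (V : Matrix (Fin L) (Fin L) ℂ) * star (V : Matrix (Fin L) (Fin L) ℂ) = 1 :=
    Unitary.coe_mul_star_self V
  have hVh : star (V : Matrix (Fin L) (Fin L) ℂ) * h =
      Matrix.diagonal D * star (V : Matrix (Fin L) (Fin L) ℂ) := by
    conv_lhs => rw [hspec]
    rw [← mul_assoc, ← mul_assoc, hVV, one_mul]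
  have hHb : ∀ r, quadraticHamiltonian h * b r = b r * quadraticHamiltonian h - D r • b r := by
    intro r
    simp only [b, Finset.mul_sum, Finset.sum_mul, mul_smul_comm, smul_mul_assoc,
      quadraticHamiltonian_mul_annihilation, smul_sub, Finset.sum_sub_distrib]
    congr 1
    simp only [Finset.smul_sum, smul_smul]
    rw [Finset.sum_comm]
    refine Finset.sum_congr rfl fun j _ => ?_
    rw [← Finset.sum_smul]
    congr 1
    have := congrFun (congrFun hVh r) j
    rw [Matrix.mul_apply, Matrix.diagonal_mul] at this
    exact this
  -- The commutator relation written as an intertwining relation, which passes to exponentials; the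
  -- scalar shift becomes the phase `E r`.
  have hsemi : ∀ r, SemiconjBy (b r) (X + (-(Complex.I * t * D r)) • (1 : FockOp L)) X := by
    intro r
    rw [SemiconjBy, hX, smul_mul_assoc, hHb, mul_add, mul_smul_comm, mul_smul_comm, mul_one,
      smul_sub, smul_smul, neg_smul, sub_eq_add_neg]
  have hconj : ∀ r, NormedSpace.exp X * b r * (NormedSpace.exp X).conjTranspose = E r • b r := by
    intro r
    have := Matrix.semiconjBy_exp_right (hsemi r)
    rw [SemiconjBy, Matrix.exp_add_smul_one] at this
    rw [← this, mul_smul_comm, smul_mul_assoc, mul_assoc (b r), ← Matrix.star_eq_conjTranspose,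
      Matrix.mem_unitaryGroup_iff.1 hUu, mul_one]
  have ha : ∀ i, annihilation i = ∑ r, (V : Matrix (Fin L) (Fin L) ℂ) i r • b r := by
    intro i
    simp only [b, Finset.smul_sum, smul_smul]
    rw [Finset.sum_comm]
    simp only [← Finset.sum_smul, ← Matrix.mul_apply, hVV', Matrix.one_apply, ite_smul, one_smul,
      zero_smul, Finset.sum_ite_eq, Finset.mem_univ, if_true]
  refine ⟨V * Matrix.diagonal E * star (V : Matrix (Fin L) (Fin L) ℂ), ?_, ?_⟩
  · refine mul_mem (mul_mem V.2 ?_) (star V).2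
    rw [Matrix.mem_unitaryGroup_iff, Matrix.star_eq_conjTranspose, Matrix.diagonal_conjTranspose,
      Matrix.diagonal_mul_diagonal, ← Matrix.diagonal_one]
    congr 1
    funext r
    simp only [E, D, Pi.star_apply, RCLike.star_def, ← Complex.exp_conj, ← Complex.exp_add]
    simp
  · intro i
    conv_lhs => rw [ha i]
    simp only [Finset.mul_sum, Finset.sum_mul, mul_smul_comm, smul_mul_assoc, hconj]
    simp only [b, Finset.smul_sum, smul_smul]
    rw [Finset.sum_comm]
    refine Finset.sum_congr rfl fun j _ => ?_
    rw [← Finset.sum_smul]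
    rw [Matrix.mul_apply]
    simp only [Matrix.mul_diagonal, mul_assoc]

/-- Among all `a_b`, only `a_j` takes `|{j}⟩` to the vacuum, and with sign `+1`. This yields
uniqueness of `u` and its measurability as a function of `U`. -/
lemma IsModeMatrix.apply_eq {U : FockOp L} {u : Matrix (Fin L) (Fin L) ℂ} (hu : IsModeMatrix U u)
    (i j : Fin L) : u i j = (U * annihilation i * U.conjTranspose) ∅ {j} := by
  rw [hu i, Matrix.sum_apply, Finset.sum_eq_single j]
  · simp [annihilation_apply, jordanWignerSign, Finset.filter_singleton]
  · intro b _ hb; simp [annihilation_apply, hb]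
  · simp

lemma IsModeMatrix.unique {U : FockOp L} {u v : Matrix (Fin L) (Fin L) ℂ}
    (hu : IsModeMatrix U u) (hv : IsModeMatrix U v) : u = v := by
  ext i j; rw [hu.apply_eq, hv.apply_eq]

lemma IsModeMatrix.mem_unitaryGroup {U : FockOp L} {u : Matrix (Fin L) (Fin L) ℂ}
    (hu : IsModeMatrix U u) (hU : IsFreeNumberPreserving U) :
    u ∈ Matrix.unitaryGroup (Fin L) ℂ := by
  obtain ⟨v, hv, hv'⟩ := exists_isModeMatrix hU
  rwa [hu.unique hv']

lemma IsModeMatrix.conj_creation {U : FockOp L} {u : Matrix (Fin L) (Fin L) ℂ}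
    (hu : IsModeMatrix U u) (i : Fin L) :
    U * creation i * U.conjTranspose = ∑ j, star (u i j) • creation j := by
  have := congrArg Matrix.conjTranspose (hu i)
  simpa [Matrix.conjTranspose_mul, Matrix.conjTranspose_sum, Matrix.conjTranspose_smul,
    conjTranspose_annihilation, mul_assoc] using this

lemma IsModeMatrix.conjTranspose {U : FockOp L} {u : Matrix (Fin L) (Fin L) ℂ}
    (hu : IsModeMatrix U u) (hU : U ∈ Matrix.unitaryGroup (Finset (Fin L)) ℂ)
    (huu : u ∈ Matrix.unitaryGroup (Fin L) ℂ) : IsModeMatrix U.conjTranspose u.conjTranspose := by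
  intro i
  have hUU : U.conjTranspose * U = 1 := Matrix.mem_unitaryGroup_iff'.1 hU
  -- The defining relations are solved for `a_i` using `u† u = 1`; conjugating by `U†` then cancels
  -- `U`.
  have h1 : annihilation i = ∑ r, u.conjTranspose i r • (U * annihilation r * U.conjTranspose) := by
    simp only [hu _, Finset.smul_sum, smul_smul]
    rw [Finset.sum_comm]
    have : u.conjTranspose * u = 1 := Matrix.mem_unitaryGroup_iff'.1 huu
    simp only [← Finset.sum_smul, ← Matrix.mul_apply, this, Matrix.one_apply, ite_smul, one_smul,
      zero_smul, Finset.sum_ite_eq, Finset.mem_univ, if_true]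
  conv_lhs => rw [h1]
  simp only [Finset.mul_sum, Finset.sum_mul, mul_smul_comm, smul_mul_assoc,
    Matrix.conjTranspose_conjTranspose]
  refine Finset.sum_congr rfl fun r _ => ?_
  rw [mul_assoc, mul_assoc, mul_assoc, hUU, ← mul_assoc, ← mul_assoc, hUU, one_mul, mul_one]

lemma conj_list_prod {n : Type*} [Fintype n] [DecidableEq n] {U : Matrix n n ℂ}
    (hU : U ∈ Matrix.unitaryGroup n ℂ) (l : List (Matrix n n ℂ)) :
    U * l.prod * U.conjTranspose = (l.map fun X => U * X * U.conjTranspose).prod := by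
  have hUU : U.conjTranspose * U = 1 := Matrix.mem_unitaryGroup_iff'.1 hU
  have hUU' : U * U.conjTranspose = 1 := Matrix.mem_unitaryGroup_iff.1 hU
  induction l with
  | nil => simp [hUU']
  | cons X l ih =>
    rw [List.map_cons, List.prod_cons, List.prod_cons, ← ih]
    simp only [mul_assoc]
    rw [← mul_assoc U.conjTranspose, hUU, one_mul]

/-- Conjugation of a correlation operator by a free unitary. -/
lemma IsModeMatrix.conj_corrOp {U : FockOp L} {u : Matrix (Fin L) (Fin L) ℂ}
    (hu : IsModeMatrix U u) (hU : U ∈ Matrix.unitaryGroup (Finset (Fin L)) ℂ) {k : ℕ}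
    (i j : Fin k → Fin L) :
    U * corrOp i j * U.conjTranspose = ∑ p : Fin k → Fin L, ∑ q : Fin k → Fin L,
      ((∏ a, star (u (i a) (p a))) * ∏ a, u (j a) (q a)) • corrOp p q := by
  have hUU : U.conjTranspose * U = 1 := Matrix.mem_unitaryGroup_iff'.1 hU
  have h1 : U * corrOp i j * U.conjTranspose =
      (U * (List.ofFn fun r => creation (i r)).prod * U.conjTranspose) *
      (U * (List.ofFn fun r => annihilation (j r)).prod * U.conjTranspose) := by
    simp only [corrOp, mul_assoc]
    rw [← mul_assoc U.conjTranspose U, hUU, one_mul]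
  rw [h1, conj_list_prod hU, conj_list_prod hU, List.map_ofFn, List.map_ofFn]
  simp only [Function.comp_def, hu _, hu.conj_creation]
  rw [prod_ofFn_sum_smul k creation fun r j => star (u (i r) j),
    prod_ofFn_sum_smul k annihilation fun r q => u (j r) q, Finset.sum_mul_sum]
  simp only [smul_mul_smul_comm, corrOp]

end ModeMatrix

/-! ### Bounded measurable functions and integrability of the matrix entries. -/

section Integrability

variable {Ω : Type*} [MeasurableSpace Ω]

/-- Measurable and uniformly bounded complex functions. -/
def IsBoundedMeasurable (f : Ω → ℂ) : Prop := Measurable f ∧ ∃ C : ℝ, ∀ ω, ‖f ω‖ ≤ C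

namespace IsBoundedMeasurable

lemma const (c : ℂ) : IsBoundedMeasurable fun _ : Ω => c := ⟨measurable_const, ‖c‖, fun _ => le_rfl⟩

lemma add {f g : Ω → ℂ} (hf : IsBoundedMeasurable f) (hg : IsBoundedMeasurable g) :
    IsBoundedMeasurable fun ω => f ω + g ω := by
  obtain ⟨hf, C, hC⟩ := hf
  obtain ⟨hg, D, hD⟩ := hg
  exact ⟨hf.add hg, C + D, fun ω => (norm_add_le _ _).trans (add_le_add (hC ω) (hD ω))⟩

lemma mul {f g : Ω → ℂ} (hf : IsBoundedMeasurable f) (hg : IsBoundedMeasurable g) :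
    IsBoundedMeasurable fun ω => f ω * g ω := by
  obtain ⟨hf, C, hC⟩ := hf
  obtain ⟨hg, D, hD⟩ := hg
  refine ⟨hf.mul hg, C * D, fun ω => ?_⟩
  rw [norm_mul]
  exact mul_le_mul (hC ω) (hD ω) (norm_nonneg _) ((norm_nonneg _).trans (hC ω))

lemma star {f : Ω → ℂ} (hf : IsBoundedMeasurable f) :
    IsBoundedMeasurable fun ω => star (f ω) := by
  obtain ⟨hf, C, hC⟩ := hf
  exact ⟨continuous_star.measurable.comp hf, C, fun ω => by rw [norm_star]; exact hC ω⟩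

lemma sum {ι : Type*} (s : Finset ι) {f : ι → Ω → ℂ} (hf : ∀ i, IsBoundedMeasurable (f i)) :
    IsBoundedMeasurable fun ω => ∑ i ∈ s, f i ω := by
  classical
  induction s using Finset.induction_on with
  | empty => simpa using const 0
  | insert a s ha ih => simpa [Finset.sum_insert ha] using (hf a).add ih

lemma prod {ι : Type*} (s : Finset ι) {f : ι → Ω → ℂ} (hf : ∀ i, IsBoundedMeasurable (f i)) :
    IsBoundedMeasurable fun ω => ∏ i ∈ s, f i ω := by
  classical
  induction s using Finset.induction_on with
  | empty => simpa using const 1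
  | insert a s ha ih => simpa [Finset.prod_insert ha] using (hf a).mul ih

lemma matrix_mul {l m n : Type*} [Fintype m] {A : Ω → Matrix l m ℂ} {B : Ω → Matrix m n ℂ}
    (hA : ∀ i j, IsBoundedMeasurable fun ω => A ω i j)
    (hB : ∀ i j, IsBoundedMeasurable fun ω => B ω i j) (i : l) (j : n) :
    IsBoundedMeasurable fun ω => (A ω * B ω) i j := by
  simp only [Matrix.mul_apply]
  exact sum _ fun r => (hA i r).mul (hB r j)

lemma integrable {f : Ω → ℂ} (hf : IsBoundedMeasurable f) (μ : Measure Ω) [IsFiniteMeasure μ] :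
    Integrable f μ := by
  obtain ⟨hf, C, hC⟩ := hf
  exact Integrable.of_bound hf.aestronglyMeasurable C (Filter.Eventually.of_forall hC)

end IsBoundedMeasurable

variable {L : ℕ} {U : Ω → FockOp L}

lemma isBoundedMeasurable_of_isFreeNumberPreserving
    (hmeas : ∀ S T, Measurable fun ω => U ω S T) (hfree : ∀ ω, IsFreeNumberPreserving (U ω))
    (S T : Finset (Fin L)) : IsBoundedMeasurable fun ω => U ω S T :=
  ⟨hmeas S T, 1, fun ω => entry_norm_bound_of_unitary (hfree ω).mem_unitaryGroup S T⟩

lemma isBoundedMeasurable_channelIntegrand (hU : ∀ S T, IsBoundedMeasurable fun ω => U ω S T)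
    (A : FockOp L) (n S T : Finset (Fin L)) :
    IsBoundedMeasurable fun ω => channelIntegrand (U ω) A n S T := by
  have hU' : ∀ S T, IsBoundedMeasurable fun ω => (U ω).conjTranspose S T :=
    fun S T => (hU T S).star
  have h1 := IsBoundedMeasurable.matrix_mul (IsBoundedMeasurable.matrix_mul hU
    (B := fun _ => A) fun S T => IsBoundedMeasurable.const (A S T)) hU' n n
  have h2 := IsBoundedMeasurable.matrix_mul (IsBoundedMeasurable.matrix_mul hU'
    (B := fun _ => Matrix.single n n (1 : ℂ))
    fun S T => IsBoundedMeasurable.const (Matrix.single n n (1 : ℂ) S T)) hU S T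
  exact h1.mul h2

/-- No measurability of `u` is assumed: its entries are polynomials in the entries of `U` and their
conjugates. -/
lemma isBoundedMeasurable_modeMatrix (hU : ∀ S T, IsBoundedMeasurable fun ω => U ω S T)
    {u : Ω → Matrix (Fin L) (Fin L) ℂ} (hu : ∀ ω, IsModeMatrix (U ω) (u ω)) (i j : Fin L) :
    IsBoundedMeasurable fun ω => u ω i j := by
  simp only [fun ω => (hu ω).apply_eq i j]
  have hU' : ∀ S T, IsBoundedMeasurable fun ω => (U ω).conjTranspose S T :=
    fun S T => (hU T S).star
  exact IsBoundedMeasurable.matrix_mul (IsBoundedMeasurable.matrix_mul hU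
    (B := fun _ => annihilation i) fun S T => IsBoundedMeasurable.const (annihilation i S T))
    hU' ∅ {j}

lemma isBoundedMeasurable_moment {u : Ω → Matrix (Fin L) (Fin L) ℂ}
    (hu : ∀ i j, IsBoundedMeasurable fun ω => u ω i j) {t : ℕ} (x y p q : Fin t → Fin L) :
    IsBoundedMeasurable
      fun ω => (∏ a, star (u ω (x a) (p a))) * ∏ a, u ω (y a) (q a) :=
  (IsBoundedMeasurable.prod _ fun _ => (hu _ _).star).mul (.prod _ fun _ => hu _ _)

end Integrability

/-! ### The coefficients of a single unitary and their symmetries. -/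

section Coefficients

variable {L k : ℕ}

/-- The product of matrix entries whose expectation is the moment entry
`Φ_{2k}(i, m, j, l; p, p, p, p)`. -/
noncomputable def modeProduct (u : Matrix (Fin L) (Fin L) ℂ) (i m j l p : Fin k → Fin L) : ℂ :=
  (∏ a, star (u (i a) (p a))) * (∏ a, star (u (m a) (p a))) *
    (∏ a, u (j a) (p a)) * ∏ a, u (l a) (p a)

lemma modeProduct_comp_perm (u : Matrix (Fin L) (Fin L) ℂ) (i m j l p : Fin k → Fin L)
    (ρ : Equiv.Perm (Fin k)) :
    modeProduct u (i ∘ ρ) (m ∘ ρ) (j ∘ ρ) (l ∘ ρ) (p ∘ ρ) = modeProduct u i m j l p := by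
  simp only [modeProduct, Function.comp_apply]
  rw [Equiv.prod_comp ρ fun a => star (u (i a) (p a)),
    Equiv.prod_comp ρ fun a => star (u (m a) (p a)),
    Equiv.prod_comp ρ fun a => u (j a) (p a), Equiv.prod_comp ρ fun a => u (l a) (p a)]

lemma star_modeProduct (u : Matrix (Fin L) (Fin L) ℂ) (i m j l p : Fin k → Fin L) :
    star (modeProduct u i m j l p) = modeProduct u l j m i p := by
  simp only [modeProduct, star_mul', star_prod, star_star]
  ring

lemma momentEntry_append {Ω : Type*} [MeasurableSpace Ω] (μ : Measure Ω)
    (u : Ω → Matrix (Fin L) (Fin L) ℂ) (i m j l p : Fin k → Fin L) :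
    momentEntry μ u (Fin.append i m) (Fin.append j l) (Fin.append p p) (Fin.append p p) =
      ∫ ω, modeProduct (u ω) i m j l p ∂μ := by
  simp only [momentEntry, Fin.prod_univ_add, Fin.append_left, Fin.append_right, modeProduct,
    mul_assoc]

/-- The signed sum of `F (σ, π, τ, p)` defining the coefficients. -/
noncomputable def signedPermSum (F : (Fin k → Fin L) → Equiv.Perm (Fin k) → Equiv.Perm (Fin k) →
    Equiv.Perm (Fin k) → ℂ) : ℂ :=
  ∑ p : Fin k → Fin L, ∑ π : Equiv.Perm (Fin k), ∑ σ : Equiv.Perm (Fin k),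
    ∑ τ : Equiv.Perm (Fin k), ((Equiv.Perm.sign (π * σ * τ) : ℤ) : ℂ) * F p π σ τ

/-- Left translations will absorb permutations of `j`, `m`, `l`; the common right translation `δ`,
applied to `p` as well, absorbs those of `i`. It enters the sign three times, which counts once. -/
lemma signedPermSum_reindex (F : (Fin k → Fin L) → Equiv.Perm (Fin k) → Equiv.Perm (Fin k) →
    Equiv.Perm (Fin k) → ℂ) (α β γ δ : Equiv.Perm (Fin k)) :
    signedPermSum (fun p π σ τ => F (p ∘ δ) (α * π * δ) (β * σ * δ) (γ * τ * δ)) =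
      ((Equiv.Perm.sign (α * β * γ * δ) : ℤ) : ℂ) * signedPermSum F := by
  unfold signedPermSum
  simp only [Finset.mul_sum]
  let e : Equiv.Perm (Fin k) → Equiv.Perm (Equiv.Perm (Fin k)) := fun α =>
    (Equiv.mulLeft α).trans (Equiv.mulRight δ)
  refine Fintype.sum_equiv (δ.symm.arrowCongr (Equiv.refl _)) _ _ fun p => ?_
  refine Fintype.sum_equiv (e α) _ _ fun π => Fintype.sum_equiv (e β) _ _ fun σ =>
    Fintype.sum_equiv (e γ) _ _ fun τ => ?_
  rw [← mul_assoc]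
  congr 1
  simp only [e, Equiv.trans_apply, Equiv.coe_mulLeft, Equiv.coe_mulRight, map_mul]
  rw [← Int.cast_mul, ← Units.val_mul]
  congr 2
  have h : ∀ x : ℤˣ, x * x = 1 := Int.units_mul_self
  generalize Equiv.Perm.sign α = a
  generalize Equiv.Perm.sign β = b
  generalize Equiv.Perm.sign γ = c
  generalize Equiv.Perm.sign δ = d
  generalize Equiv.Perm.sign π = x
  generalize Equiv.Perm.sign σ = y
  generalize Equiv.Perm.sign τ = z
  calc x * y * z = (a * a) * (b * b) * (c * c) * (d * d) * (d * d) * (x * y * z) := by simp [h]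
    _ = _ := by ac_rfl

/-- The coefficient of the channel for a single unitary, before averaging. -/
noncomputable def pointCoeff (u : Matrix (Fin L) (Fin L) ℂ) (i j l m : Fin k → Fin L) : ℂ :=
  ((k.factorial : ℂ) ^ 2)⁻¹ *
    signedPermSum fun p π σ τ => modeProduct u i (m ∘ σ) (j ∘ π) (l ∘ τ) p

lemma pointCoeff_comp_perm (u : Matrix (Fin L) (Fin L) ℂ) (i j l m : Fin k → Fin L)
    (ρ : Equiv.Perm (Fin k)) :
    pointCoeff u (i ∘ ρ) j l m = ((Equiv.Perm.sign ρ : ℤ) : ℂ) * pointCoeff u i j l m ∧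
    pointCoeff u i (j ∘ ρ) l m = ((Equiv.Perm.sign ρ : ℤ) : ℂ) * pointCoeff u i j l m ∧
    pointCoeff u i j (l ∘ ρ) m = ((Equiv.Perm.sign ρ : ℤ) : ℂ) * pointCoeff u i j l m ∧
    pointCoeff u i j l (m ∘ ρ) = ((Equiv.Perm.sign ρ : ℤ) : ℂ) * pointCoeff u i j l m := by
  let F := fun p (π σ τ : Equiv.Perm (Fin k)) => modeProduct u i (m ∘ σ) (j ∘ π) (l ∘ τ) p
  have hl : ∀ c s : ℂ, c * (s * signedPermSum F) = s * (c * signedPermSum F) := fun c s => by ring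
  unfold pointCoeff
  refine ⟨?_, ?_, ?_, ?_⟩ <;> rw [← hl]
  -- Since `i` carries no summed permutation, all factors are relabelled by `ρ⁻¹`, which moves `ρ`
  -- from `i` to the other tuples.
  · have := signedPermSum_reindex F 1 1 1 ρ⁻¹
    rw [one_mul, one_mul, one_mul, Equiv.Perm.sign_inv] at this
    rw [← this]
    congr 2
    funext p π σ τ
    rw [← modeProduct_comp_perm u _ _ _ _ p ρ⁻¹]
    simp only [F, Function.comp_assoc, one_mul, ← Equiv.Perm.coe_mul, mul_inv_cancel,
      Equiv.Perm.coe_one, Function.comp_id]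
  · have := signedPermSum_reindex F ρ 1 1 1
    simp only [one_mul, mul_one, Equiv.Perm.coe_one, Function.comp_id] at this
    rw [← this]
    rfl
  · have := signedPermSum_reindex F 1 1 ρ 1
    simp only [one_mul, mul_one, Equiv.Perm.coe_one, Function.comp_id] at this
    rw [← this]
    rfl
  · have := signedPermSum_reindex F 1 ρ 1 1
    simp only [one_mul, mul_one, Equiv.Perm.coe_one, Function.comp_id] at this
    rw [← this]
    rfl

/-- The substitution behind Hermiticity. Conjugation exchanges `π` with `σ` and leaves `τ` on `i`
instead of `l`; relabelling by `τ⁻¹` moves it back. The sign is unchanged because `τ⁻¹` occurs three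
times. -/
lemma signedPermSum_inv (F : (Fin k → Fin L) → Equiv.Perm (Fin k) → Equiv.Perm (Fin k) →
    Equiv.Perm (Fin k) → ℂ) :
    signedPermSum (fun p π σ τ => F (p ∘ ⇑τ⁻¹) (σ * τ⁻¹) (π * τ⁻¹) τ⁻¹) = signedPermSum F := by
  have hcomm : ∀ G : (Fin k → Fin L) → Equiv.Perm (Fin k) → Equiv.Perm (Fin k) →
      Equiv.Perm (Fin k) → ℂ, (∑ p, ∑ π, ∑ σ, ∑ τ, G p π σ τ) =
      ∑ τ, ∑ π, ∑ σ, ∑ p, G p π σ τ := fun G => by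
    rw [Finset.sum_congr rfl fun p _ => Finset.sum_comm_cycle, Finset.sum_comm]
    exact Finset.sum_congr rfl fun τ _ => Finset.sum_comm_cycle.symm
  unfold signedPermSum
  -- The substitutions in `p`, `π`, `σ` depend on `τ`, so `τ` has to be the outermost index.
  rw [hcomm, hcomm]
  refine Fintype.sum_equiv (Equiv.inv _) _ _ fun τ => ?_
  rw [Finset.sum_comm]
  refine Fintype.sum_equiv (Equiv.mulRight τ⁻¹) _ _ fun σ => Fintype.sum_equiv
    (Equiv.mulRight τ⁻¹) _ _ fun π => Fintype.sum_equiv (τ.arrowCongr (Equiv.refl _)) _ _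
      fun p => ?_
  have hs : Equiv.Perm.sign (π * σ * τ) = Equiv.Perm.sign (σ * τ⁻¹ * (π * τ⁻¹) * τ⁻¹) := by
    simp only [map_mul, Equiv.Perm.sign_inv]
    have h : Equiv.Perm.sign τ * Equiv.Perm.sign τ = 1 := Int.units_mul_self _
    calc _ = Equiv.Perm.sign π * Equiv.Perm.sign σ * Equiv.Perm.sign τ * 1 := by simp
      _ = _ := by rw [← h]; ac_rfl
  rw [hs]
  rfl

lemma star_signedPermSum (F : (Fin k → Fin L) → Equiv.Perm (Fin k) → Equiv.Perm (Fin k) →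
    Equiv.Perm (Fin k) → ℂ) :
    star (signedPermSum F) = signedPermSum fun p π σ τ => star (F p π σ τ) := by
  have hstar : ∀ s : ℤ, star (s : ℂ) = s := fun s => by simp
  simp only [signedPermSum, star_sum, star_mul', hstar]

lemma star_pointCoeff (u : Matrix (Fin L) (Fin L) ℂ) (i j l m : Fin k → Fin L) :
    star (pointCoeff u l m i j) = pointCoeff u i j l m := by
  have hk : star ((k.factorial : ℂ) ^ 2)⁻¹ = ((k.factorial : ℂ) ^ 2)⁻¹ := by simp
  rw [pointCoeff, pointCoeff, star_mul', hk, star_signedPermSum,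
    ← signedPermSum_inv fun p π σ τ => modeProduct u i (m ∘ σ) (j ∘ π) (l ∘ τ) p]
  congr 2
  funext p π σ τ
  rw [star_modeProduct, ← modeProduct_comp_perm u _ _ _ _ p τ⁻¹]
  simp only [Function.comp_assoc, ← Equiv.Perm.coe_mul, mul_inv_cancel, Equiv.Perm.coe_one,
    Function.comp_id]

/-- Each pair `(σ, τ)` contributes the same operator, since the signs compensate the reordering in
`corrOp`; the right side is the average over all `(k!)²` pairs. -/
lemma sum_smul_corrOp_antisymmetrize (c : (Fin k → Fin L) → (Fin k → Fin L) → ℂ) :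
    ∑ l, ∑ m, c l m • corrOp l m = ∑ l, ∑ m, (((k.factorial : ℂ) ^ 2)⁻¹ *
      ∑ σ : Equiv.Perm (Fin k), ∑ τ : Equiv.Perm (Fin k),
        (((Equiv.Perm.sign τ : ℤ) : ℂ) * ((Equiv.Perm.sign σ : ℤ) : ℂ)) * c (l ∘ τ) (m ∘ σ)) •
          corrOp l m := by
  have h : ∀ σ τ : Equiv.Perm (Fin k), ∑ l, ∑ m, ((((Equiv.Perm.sign τ : ℤ) : ℂ) *
      ((Equiv.Perm.sign σ : ℤ) : ℂ)) * c (l ∘ τ) (m ∘ σ)) • corrOp l m =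
      ∑ l, ∑ m, c l m • corrOp l m := fun σ τ => by
    refine Fintype.sum_equiv (τ.symm.arrowCongr (Equiv.refl _)) _ _ fun l =>
      Fintype.sum_equiv (σ.symm.arrowCongr (Equiv.refl _)) _ _ fun m => ?_
    have e : ∀ (ρ : Equiv.Perm (Fin k)) (x : Fin k → Fin L),
      ρ.symm.arrowCongr (Equiv.refl _) x = x ∘ ρ := fun _ _ => rfl
    rw [e, e, corrOp_comp_perm, smul_smul, mul_comm]
  have hk : (k.factorial : ℂ) ≠ 0 := Nat.cast_ne_zero.2 k.factorial_ne_zero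
  calc _ = ((k.factorial : ℂ) ^ 2)⁻¹ • ∑ σ : Equiv.Perm (Fin k), ∑ τ : Equiv.Perm (Fin k),
        ∑ l, ∑ m, c l m • corrOp l m := by
        simp only [Finset.sum_const, Finset.card_univ, Fintype.card_perm, Fintype.card_fin,
          ← Nat.cast_smul_eq_nsmul ℂ, smul_smul]
        rw [show ((k.factorial : ℂ) ^ 2)⁻¹ * (k.factorial * k.factorial) = 1 by field_simp,
          one_smul]
    _ = ((k.factorial : ℂ) ^ 2)⁻¹ • ∑ σ : Equiv.Perm (Fin k), ∑ τ : Equiv.Perm (Fin k),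
        ∑ l, ∑ m, ((((Equiv.Perm.sign τ : ℤ) : ℂ) *
      ((Equiv.Perm.sign σ : ℤ) : ℂ)) * c (l ∘ τ) (m ∘ σ)) • corrOp l m := by simp only [h]
    _ = _ := by
      simp only [Finset.mul_sum, Finset.sum_smul, Finset.smul_sum, smul_smul]
      rw [Finset.sum_comm_cycle]
      exact Finset.sum_congr rfl fun l _ => Finset.sum_comm_cycle

end Coefficients

/-! ### The channel on correlation operators, for one unitary and then on average. -/

section Channel

variable {L k : ℕ}

/-- The channel of a single unitary: dephasing in the rotated Fock basis. -/
lemma sum_channelIntegrand (U A : FockOp L) (S T : Finset (Fin L)) :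
    ∑ n, channelIntegrand U A n S T =
      (U.conjTranspose * Matrix.diagonal (fun n => (U * A * U.conjTranspose) n n) * U) S T := by
  have h : Matrix.diagonal (fun n => (U * A * U.conjTranspose) n n) =
      ∑ n, (U * A * U.conjTranspose) n n • Matrix.single n n (1 : ℂ) := by
    rw [← Matrix.sum_single_eq_diagonal]
    simp [Matrix.smul_single]
  rw [h]
  simp only [Finset.mul_sum, Finset.sum_mul, mul_smul_comm, smul_mul_assoc, Matrix.sum_apply,
    Matrix.smul_apply, smul_eq_mul, channelIntegrand]

lemma sum_channelIntegrand_corrOp {U : FockOp L} {u : Matrix (Fin L) (Fin L) ℂ}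
    (hu : IsModeMatrix U u) (hU : IsFreeNumberPreserving U) (i j : Fin k → Fin L)
    (S T : Finset (Fin L)) :
    ∑ n, channelIntegrand U (corrOp i j) n S T =
      ∑ l : Fin k → Fin L, ∑ m : Fin k → Fin L, pointCoeff u i j l m * corrOp l m S T := by
  have hUu := hU.mem_unitaryGroup
  have hUs : U.conjTranspose ∈ Matrix.unitaryGroup (Finset (Fin L)) ℂ :=
    (star ⟨U, hUu⟩ : Matrix.unitaryGroup (Finset (Fin L)) ℂ).2
  have hus := hu.conjTranspose hUu (hu.mem_unitaryGroup hU)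
  have hconj : ∀ p : Fin k → Fin L, U.conjTranspose * corrOp p p * U =
      ∑ l : Fin k → Fin L, ∑ m : Fin k → Fin L,
        ((∏ a, u (l a) (p a)) * ∏ a, star (u (m a) (p a))) • corrOp l m := fun p => by
    have := hus.conj_corrOp hUs p p
    simpa only [Matrix.conjTranspose_conjTranspose, Matrix.conjTranspose_apply, star_star]
      using this
  rw [sum_channelIntegrand, hu.conj_corrOp hUu, diagonal_sum_smul_corrOp]
  have hop : U.conjTranspose * (∑ p : Fin k → Fin L, ∑ π : Equiv.Perm (Fin k),
      (((Equiv.Perm.sign π : ℤ) : ℂ) * ((∏ a, star (u (i a) (p a))) *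
        ∏ a, u (j a) ((p ∘ π) a))) • corrOp p p) * U =
      ∑ l : Fin k → Fin L, ∑ m : Fin k → Fin L, (∑ p : Fin k → Fin L,
        ∑ π : Equiv.Perm (Fin k), ((Equiv.Perm.sign π : ℤ) : ℂ) *
          modeProduct u i m (j ∘ π) l p) • corrOp l m := by
    -- Replacing `π` by its inverse, which has the same sign, transfers the permutation from `p` to
    -- `j`.
    have hπ : ∀ p : Fin k → Fin L, ∑ π : Equiv.Perm (Fin k),
        ((Equiv.Perm.sign π : ℤ) : ℂ) * ((∏ a, star (u (i a) (p a))) *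
          ∏ a, u (j a) ((p ∘ π) a)) = ∑ π : Equiv.Perm (Fin k),
        ((Equiv.Perm.sign π : ℤ) : ℂ) * ((∏ a, star (u (i a) (p a))) *
          ∏ a, u (j (π a)) (p a)) := fun p => by
      refine Fintype.sum_equiv (Equiv.inv _) _ _ fun π => ?_
      rw [Equiv.inv_apply, Equiv.Perm.sign_inv, ← Equiv.prod_comp π fun a => u (j (π⁻¹ a)) (p a)]
      simp
    simp only [← Finset.sum_smul, hπ, Finset.mul_sum, Finset.sum_mul, mul_smul_comm,
      smul_mul_assoc, hconj]
    simp only [Finset.smul_sum, smul_smul]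
    rw [Finset.sum_comm]
    refine Finset.sum_congr rfl fun l _ => ?_
    rw [Finset.sum_comm]
    refine Finset.sum_congr rfl fun m _ => ?_
    rw [← Finset.sum_smul]
    congr 1
    refine Finset.sum_congr rfl fun p _ => ?_
    rw [Finset.sum_mul]
    refine Finset.sum_congr rfl fun π _ => ?_
    simp only [modeProduct, Function.comp_apply]
    ring
  -- So far only `π` occurs; antisymmetrising in `l` and `m` produces `τ`, `σ` and `(k!)⁻²`.
  rw [hop, sum_smul_corrOp_antisymmetrize]
  simp only [Matrix.sum_apply, Matrix.smul_apply, smul_eq_mul]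
  refine Finset.sum_congr rfl fun l _ => Finset.sum_congr rfl fun m _ => ?_
  congr 2
  simp only [signedPermSum, Finset.mul_sum]
  rw [Finset.sum_congr rfl fun σ _ => Finset.sum_comm, Finset.sum_comm,
    Finset.sum_congr rfl fun p _ => Finset.sum_comm_cycle]
  refine Finset.sum_congr rfl fun p _ => Finset.sum_congr rfl fun π _ =>
    Finset.sum_congr rfl fun σ _ => Finset.sum_congr rfl fun τ _ => ?_
  simp only [map_mul, Units.val_mul, Int.cast_mul]
  ring

variable {Ω : Type*} [MeasurableSpace Ω] {u : Ω → Matrix (Fin L) (Fin L) ℂ}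

lemma isBoundedMeasurable_modeProduct (hu : ∀ i j, IsBoundedMeasurable fun ω => u ω i j)
    (i m j l p : Fin k → Fin L) : IsBoundedMeasurable fun ω => modeProduct (u ω) i m j l p :=
  (((IsBoundedMeasurable.prod _ fun _ => (hu _ _).star).mul
    (IsBoundedMeasurable.prod _ fun _ => (hu _ _).star)).mul
      (IsBoundedMeasurable.prod _ fun _ => hu _ _)).mul (IsBoundedMeasurable.prod _ fun _ => hu _ _)

lemma isBoundedMeasurable_pointCoeff (hu : ∀ i j, IsBoundedMeasurable fun ω => u ω i j)
    (i j l m : Fin k → Fin L) : IsBoundedMeasurable fun ω => pointCoeff (u ω) i j l m :=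
  (IsBoundedMeasurable.const _).mul <| IsBoundedMeasurable.sum _ fun _ =>
    IsBoundedMeasurable.sum _ fun _ => IsBoundedMeasurable.sum _ fun _ =>
      IsBoundedMeasurable.sum _ fun _ => (IsBoundedMeasurable.const _).mul
        (isBoundedMeasurable_modeProduct hu _ _ _ _ _)

/-- This reduces the symmetries of the averaged coefficients to pointwise identities. -/
lemma channelCoeff_eq_integral_pointCoeff (μ : Measure Ω) [IsFiniteMeasure μ]
    (hu : ∀ i j, IsBoundedMeasurable fun ω => u ω i j) (i j l m : Fin k → Fin L) :
    channelCoeff μ u i j l m = ∫ ω, pointCoeff (u ω) i j l m ∂μ := by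
  have h0 : ∀ (p : Fin k → Fin L) (π σ τ : Equiv.Perm (Fin k)), IsBoundedMeasurable fun ω =>
      ((Equiv.Perm.sign (π * σ * τ) : ℤ) : ℂ) *
        modeProduct (u ω) i (m ∘ σ) (j ∘ π) (l ∘ τ) p := fun p π σ τ =>
    (IsBoundedMeasurable.const _).mul (isBoundedMeasurable_modeProduct hu _ _ _ _ _)
  unfold channelCoeff pointCoeff signedPermSum
  rw [integral_const_mul]
  congr 1
  rw [integral_finsetSum _ fun p _ => (IsBoundedMeasurable.sum _ fun _ =>
    IsBoundedMeasurable.sum _ fun _ => IsBoundedMeasurable.sum _ fun _ => h0 _ _ _ _).integrable μ]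
  refine Finset.sum_congr rfl fun p _ => ?_
  rw [integral_finsetSum _ fun π _ => (IsBoundedMeasurable.sum _ fun _ =>
    IsBoundedMeasurable.sum _ fun _ => h0 _ _ _ _).integrable μ]
  refine Finset.sum_congr rfl fun π _ => ?_
  rw [integral_finsetSum _ fun σ _ =>
    (IsBoundedMeasurable.sum _ fun _ => h0 _ _ _ _).integrable μ]
  refine Finset.sum_congr rfl fun σ _ => ?_
  rw [integral_finsetSum _ fun τ _ => (h0 _ _ _ _).integrable μ]
  refine Finset.sum_congr rfl fun τ _ => ?_
  rw [integral_const_mul, momentEntry_append]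

lemma measurementChannel_corrOp (μ : Measure Ω) [IsFiniteMeasure μ] {U : Ω → FockOp L}
    (hmeas : ∀ S T, Measurable fun ω => U ω S T) (hfree : ∀ ω, IsFreeNumberPreserving (U ω))
    (hu : ∀ ω, IsModeMatrix (U ω) (u ω)) (i j : Fin k → Fin L) :
    measurementChannel μ U (corrOp i j) =
      ∑ l : Fin k → Fin L, ∑ m : Fin k → Fin L, channelCoeff μ u i j l m • corrOp l m := by
  have hU := isBoundedMeasurable_of_isFreeNumberPreserving hmeas hfree
  have hub := isBoundedMeasurable_modeMatrix hU hu
  have hc : ∀ l m S T, IsBoundedMeasurable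
      fun ω => pointCoeff (u ω) i j l m * corrOp l m S T := fun l m S T =>
    (isBoundedMeasurable_pointCoeff hub i j l m).mul (IsBoundedMeasurable.const _)
  ext S T
  rw [measurementChannel, Matrix.of_apply, ← integral_finsetSum _ fun n _ =>
    (isBoundedMeasurable_channelIntegrand hU _ n S T).integrable μ]
  simp only [fun ω => sum_channelIntegrand_corrOp (hu ω) (hfree ω) i j S T, Matrix.sum_apply,
    Matrix.smul_apply, smul_eq_mul]
  rw [integral_finsetSum _ fun l _ =>
    (IsBoundedMeasurable.sum _ fun m => hc l m S T).integrable μ]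
  refine Finset.sum_congr rfl fun l _ => ?_
  rw [integral_finsetSum _ fun m _ => (hc l m S T).integrable μ]
  refine Finset.sum_congr rfl fun m _ => ?_
  rw [integral_mul_const, channelCoeff_eq_integral_pointCoeff μ hub]

lemma channelIntegrand_add (U A B : FockOp L) (n S T : Finset (Fin L)) :
    channelIntegrand U (A + B) n S T = channelIntegrand U A n S T + channelIntegrand U B n S T := by
  simp only [channelIntegrand, mul_add, add_mul, Matrix.add_apply]

lemma channelIntegrand_smul (U A : FockOp L) (c : ℂ) (n S T : Finset (Fin L)) :
    channelIntegrand U (c • A) n S T = c * channelIntegrand U A n S T := by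
  simp only [channelIntegrand, mul_smul_comm, smul_mul_assoc, Matrix.smul_apply, smul_eq_mul,
    mul_assoc]

lemma measurementChannel_add (μ : Measure Ω) [IsFiniteMeasure μ] {U : Ω → FockOp L}
    (hU : ∀ S T, IsBoundedMeasurable fun ω => U ω S T) (A B : FockOp L) :
    measurementChannel μ U (A + B) = measurementChannel μ U A + measurementChannel μ U B := by
  ext S T
  simp only [measurementChannel, Matrix.add_apply, Matrix.of_apply, ← Finset.sum_add_distrib,
    channelIntegrand_add]
  refine Finset.sum_congr rfl fun n _ => ?_
  exact integral_add ((isBoundedMeasurable_channelIntegrand hU A n S T).integrable μ)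
    ((isBoundedMeasurable_channelIntegrand hU B n S T).integrable μ)

lemma measurementChannel_smul (μ : Measure Ω) (U : Ω → FockOp L) (c : ℂ) (A : FockOp L) :
    measurementChannel μ U (c • A) = c • measurementChannel μ U A := by
  ext S T
  simp only [measurementChannel, Matrix.smul_apply, Matrix.of_apply, channelIntegrand_smul,
    integral_const_mul, smul_eq_mul, Finset.mul_sum]

lemma measurementChannel_mem_corrSubspace (μ : Measure Ω) [IsFiniteMeasure μ] {U : Ω → FockOp L}
    (hmeas : ∀ S T, Measurable fun ω => U ω S T) (hfree : ∀ ω, IsFreeNumberPreserving (U ω))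
    {A : FockOp L} (hA : A ∈ corrSubspace L k) :
    measurementChannel μ U A ∈ corrSubspace L k := by
  have hU := isBoundedMeasurable_of_isFreeNumberPreserving hmeas hfree
  -- An arbitrary choice suffices: uniqueness makes it measurable, via `IsModeMatrix.apply_eq`.
  choose u _ hu using fun ω => exists_isModeMatrix (hfree ω)
  induction hA using Submodule.span_induction with
  | mem A h =>
    obtain ⟨i, j, rfl⟩ := h
    rw [measurementChannel_corrOp μ hmeas hfree hu]
    exact Submodule.sum_mem _ fun l _ => Submodule.sum_mem _ fun m _ =>
      Submodule.smul_mem _ _ (Submodule.subset_span ⟨l, m, rfl⟩)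
  | zero =>
    have := measurementChannel_smul μ U 0 0
    rw [zero_smul, zero_smul] at this
    rw [this]; exact Submodule.zero_mem _
  | add A B _ _ hA hB => rw [measurementChannel_add μ hU]; exact Submodule.add_mem _ hA hB
  | smul c A _ hA => rw [measurementChannel_smul]; exact Submodule.smul_mem _ _ hA

end Channel

theorem mainTheorem6 {Ω : Type*} [MeasurableSpace Ω] (μ : Measure Ω) [IsProbabilityMeasure μ]
    (L : ℕ) (U : Ω → FockOp L) (hmeas : ∀ S T, Measurable fun ω => U ω S T)
    (hfree : ∀ ω, IsFreeNumberPreserving (U ω)) :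
    -- the mode space unitary of each `U ω` exists and is unique
    (∀ ω, ∃ v ∈ Matrix.unitaryGroup (Fin L) ℂ, IsModeMatrix (U ω) v ∧
      ∀ w, IsModeMatrix (U ω) w → w = v) ∧
    -- the expectations in the measurement channel are well defined
    (∀ A n S T, Integrable (fun ω => channelIntegrand (U ω) A n S T) μ) ∧
    -- the channel is block diagonal with respect to the `2k`-point subspaces
    (∀ k, ∀ A ∈ corrSubspace L k, measurementChannel μ U A ∈ corrSubspace L k) ∧
    ∀ u : Ω → Matrix (Fin L) (Fin L) ℂ, (∀ ω, IsModeMatrix (U ω) (u ω)) →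
      -- the expectations in the moment operator are well defined
      (∀ (t : ℕ) (x y p q : Fin t → Fin L), Integrable
        (fun ω => (∏ a, star (u ω (x a) (p a))) * ∏ a, u ω (y a) (q a)) μ) ∧
      ∀ (k : ℕ) (i j : Fin k → Fin L),
        -- the action of the channel on a `2k`-point correlation operator
        measurementChannel μ U (corrOp i j) =
          ∑ l : Fin k → Fin L, ∑ m : Fin k → Fin L, channelCoeff μ u i j l m • corrOp l m ∧
        ∀ l m : Fin k → Fin L,
          -- the coefficients written out in the entries of `u†` and `u`
          channelCoeff μ u i j l m =
            ((k.factorial : ℂ) ^ 2)⁻¹ *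
              ∑ p : Fin k → Fin L, ∑ π : Equiv.Perm (Fin k), ∑ σ : Equiv.Perm (Fin k),
                ∑ τ : Equiv.Perm (Fin k),
                  ((Equiv.Perm.sign (π * σ * τ) : ℤ) : ℂ) *
                    ∫ ω, (∏ a, (u ω).conjTranspose (p a) (i a)) *
                      (∏ a, (u ω).conjTranspose (p a) (m (σ a))) *
                      (∏ a, u ω (j (π a)) (p a)) * (∏ a, u ω (l (τ a)) (p a)) ∂μ ∧
          -- antisymmetry within each of the four groups of indices
          (∀ ρ : Equiv.Perm (Fin k),
            channelCoeff μ u (i ∘ ρ) j l m =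
              ((Equiv.Perm.sign ρ : ℤ) : ℂ) * channelCoeff μ u i j l m ∧
            channelCoeff μ u i (j ∘ ρ) l m =
              ((Equiv.Perm.sign ρ : ℤ) : ℂ) * channelCoeff μ u i j l m ∧
            channelCoeff μ u i j (l ∘ ρ) m =
              ((Equiv.Perm.sign ρ : ℤ) : ℂ) * channelCoeff μ u i j l m ∧
            channelCoeff μ u i j l (m ∘ ρ) =
              ((Equiv.Perm.sign ρ : ℤ) : ℂ) * channelCoeff μ u i j l m) ∧
          -- Hermiticity
          channelCoeff μ u i j l m = star (channelCoeff μ u l m i j) := by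
  have hU := isBoundedMeasurable_of_isFreeNumberPreserving hmeas hfree
  refine ⟨fun ω => ?_, fun A n S T =>
    (isBoundedMeasurable_channelIntegrand hU A n S T).integrable μ,
    fun k A hA => measurementChannel_mem_corrSubspace μ hmeas hfree hA, fun u hu => ?_⟩
  · obtain ⟨v, hv, hv'⟩ := exists_isModeMatrix (hfree ω)
    exact ⟨v, hv, hv', fun w hw => hw.unique hv'⟩
  have hub := isBoundedMeasurable_modeMatrix hU hu
  refine ⟨fun t x y p q => (isBoundedMeasurable_moment hub x y p q).integrable μ, fun k i j =>
    ⟨measurementChannel_corrOp μ hmeas hfree hu i j, fun l m => ⟨?_, fun ρ => ?_, ?_⟩⟩⟩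
  · simp only [channelCoeff, momentEntry_append, modeProduct, Function.comp_apply,
      Matrix.conjTranspose_apply]
  · have h := fun ω => pointCoeff_comp_perm (u ω) i j l m ρ
    simp only [channelCoeff_eq_integral_pointCoeff μ hub, (h _).1, (h _).2.1, (h _).2.2.1,
      (h _).2.2.2, integral_const_mul, and_self]
  -- Conjugation passes under the integral, where `star_pointCoeff` applies.
  · simp only [channelCoeff_eq_integral_pointCoeff μ hub, RCLike.star_def, ← integral_conj]
    simp only [← RCLike.star_def, star_pointCoeff]
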